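/- **Setting.** Let $G=(W\sqcup F,E)$ be a finite bipartite graph without multiple edges ($W$: workers, $F$: firms). For a vertex $v$, $E_v$ is the set of edges at $v$, and $X_v:=X\cap E_v$ for $X\subseteq E$. Each $w\in W$ has a linear order $>_w$ on $E_w$ and quota $1$: for $Z\subseteq E_w$, $C_w(Z)$ consists of the $>_w$-largest element of $Z$ ($C_w(\emptyset)=\emptyset$). Each $f\in F$ has a choice function $C_f:2^{E_f}\to2^{E_f}$ with $C_f(Z)\subseteq Z$ such that for all $Z'\subseteq Z\subseteq E_f$: if $C_f(Z)\subseteq Z'$ then $C_f(Z')=C_f(Z)$; $C_f(Z)\cap Z'\subseteq C_f(Z')$; and $|C_f(Z')|\le|C_f(Z)|$. A matching is any $X\subseteq E$; it is acceptable if $C_v(X_v)=X_v$ for all vertices $v$. An edge $e=wf\in E-X$ is interesting under $X$ for $v\in\{w,f\}$ if $e\in C_v(X_v\cup\{e\})$. An acceptable $X$ is stable if no $e=wf\in E-X$ is interesting under $X$ for both $w$ and $f$. For acceptable $X,Y$ write $X\preceq Y$ if $C_f(X_f\cup Y_f)=Y_f$ for all $f\in F$, and $X\prec Y$ if moreover $X\ne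 Y$. **Rotations.** Let $X$ be stable. For $w\in W$ with $X_w=\{x_w\}$, let $a_w$ be the $>_w$-largest edge among the edges $e=wf$ with $x_w>_w e$ that are interesting for $f$ under $X$, if there are such edges. If $a_w=wf$ and $C_f(X_f\cup\{a_w\})=(X_f-\{b\})\cup\{a_w\}$ with $b\in X_f$, then $b$ is called associated with $a_w$, and $(a_w,b)$ is a tandem passing $f$. Let $D(X)$ be the digraph formed by all edges $a_w$, directed from $W$ to $F$, and all edges $b$ associated with some $a_w$, directed from $F$ to $W$. As long as some $w$ has a leaving edge $a_w$ but no entering edge in the current digraph, delete $a_w$, and also delete the edge associated with $a_w$ (if any) if it is in no other tandem of the current digraph. The final digraph (without its isolated vertices) is the active graph $\Gamma(X)$; it does not depend on the order of the deletions. A rotation of $\Gamma(X)$ is a directed cycle $L$ of $\Gamma(X)$ with all edges different, which may repeat vertices of $F$, such that at each passage through a firm $f$ the entering and the leaving edge form a tandem passing $f$, and at each passage through a worker $w$ they are the unique edges of $\Gamma(X)$ entering and leaving $w$. Let $L^+$ be the set of edges of $L$ directed from $W$ to $F$ and $L^-$ the set of those directed from $F$ to $W$. The matching obtained from $X$ by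 applying $L$ is $(X-L^-)\cup L^+$. **Proposition 3.2.** Let $X,Y$ be stable matchings with $X\prec Y$. Then there is a matching $X'$ obtained from $X$ by applying a rotation of $\Gamma(X)$ such that $X'$ is stable, $X\prec X'$ and $X'\preceq Y$. Hence $Y$ is reached from $X$ through rotations: there are stable matchings $X=X_0\prec X_1\prec\dots\prec X_N=Y$ such that each $X_{i+1}$ is obtained from $X_i$ by applying a rotation of $\Gamma(X_i)$ ($0\le i<N$). -/

import Mathlib

/-- An instance of the combined boolean model with unit quotas for the workers: a finite
bipartite graph without multiple edges with parts `W` (workers) and `F` (firms), where the edge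
joining `w` and `f` is the pair `(w, f)`; a linear order `>_w` on the set of edges at each
worker `w`; and, for each firm `f`, a choice function `C_f` on the subsets of the set of edges
at `f`, subject to consistency, substitutability and cardinal monotonicity.
(The values of `gt w` and `choice f` outside the edges at `w`, resp. `f`, are irrelevant.) -/
structure CBModel (W F : Type*) [DecidableEq W] [DecidableEq F] where
  /-- the edge set of the graph -/
  E : Finset (W × F)
  /-- `gt w e e'` means `e >_w e'`: worker `w` prefers the edge `e` to the edge `e'` -/
  gt : W → W × F → W × F → Prop
  gt_irrefl : ∀ w, ∀ e ∈ E, e.1 = w → ¬ gt w e e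
  gt_trans : ∀ w, ∀ e₁ ∈ E, ∀ e₂ ∈ E, ∀ e₃ ∈ E, e₁.1 = w → e₂.1 = w → e₃.1 = w →
    gt w e₁ e₂ → gt w e₂ e₃ → gt w e₁ e₃
  gt_total : ∀ w, ∀ e₁ ∈ E, ∀ e₂ ∈ E, e₁.1 = w → e₂.1 = w →
    e₁ = e₂ ∨ gt w e₁ e₂ ∨ gt w e₂ e₁
  /-- the choice functions `C_f` of the firms -/
  choice : F → Finset (W × F) → Finset (W × F)
  choice_subset : ∀ f, ∀ Z ⊆ E.filter (fun e => e.2 = f), choice f Z ⊆ Z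
  /-- consistency -/
  choice_consistent : ∀ f, ∀ Z ⊆ E.filter (fun e => e.2 = f), ∀ Z' ⊆ Z,
    choice f Z ⊆ Z' → choice f Z' = choice f Z
  /-- substitutability -/
  choice_substitutable : ∀ f, ∀ Z ⊆ E.filter (fun e => e.2 = f), ∀ Z' ⊆ Z,
    choice f Z ∩ Z' ⊆ choice f Z'
  /-- cardinal monotonicity -/
  choice_card_mono : ∀ f, ∀ Z ⊆ E.filter (fun e => e.2 = f), ∀ Z' ⊆ Z,
    (choice f Z').card ≤ (choice f Z).card

/-- A directed bipartite graph, given by the set `toF` of its edges directed from `W` to `F`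
and the set `toW` of its edges directed from `F` to `W`. Isolated vertices are disregarded. -/
@[ext]
structure BipDigraph (W F : Type*) where
  toF : Finset (W × F)
  toW : Finset (W × F)

namespace BipDigraph

variable {W F : Type*} [DecidableEq W]

/-- The set of edges leaving the vertex `w ∈ W`. -/
def outW (D : BipDigraph W F) (w : W) : Finset (W × F) := D.toF.filter (fun e => e.1 = w)

/-- The set of edges entering the vertex `w ∈ W`. -/
def inW (D : BipDigraph W F) (w : W) : Finset (W × F) := D.toW.filter (fun e => e.1 = w)

end BipDigraph

namespace CBModel

variable {W F : Type*} [DecidableEq W] [DecidableEq F] (M : CBModel W F)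

/-- `X_w`: the edges of `X` incident to the worker `w`. -/
def atW (X : Finset (W × F)) (w : W) : Finset (W × F) := X ∩ M.E.filter (fun e => e.1 = w)

/-- `X_f`: the edges of `X` incident to the firm `f`. -/
def atF (X : Finset (W × F)) (f : F) : Finset (W × F) := X ∩ M.E.filter (fun e => e.2 = f)

open Classical in
/-- The choice function of a worker with quota one: it takes from `Z` (a set of edges at `w`)
the most preferred edge, if `Z` is nonempty. -/
noncomputable def choiceW (w : W) (Z : Finset (W × F)) : Finset (W × F) :=
  Z.filter (fun e => ∀ e' ∈ Z, e' ≠ e → M.gt w e e')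

/-- Acceptable matchings. A matching is an arbitrary set of edges. -/
def Acceptable (X : Finset (W × F)) : Prop :=
  X ⊆ M.E ∧ (∀ w, M.choiceW w (M.atW X w) = M.atW X w) ∧
    ∀ f, M.choice f (M.atF X f) = M.atF X f

/-- The edge `e = wf`, not in `X`, is interesting under `X` for its worker `w`. -/
def InterestingW (X : Finset (W × F)) (e : W × F) : Prop :=
  e ∈ M.E \ X ∧ e ∈ M.choiceW e.1 (insert e (M.atW X e.1))

/-- The edge `e = wf`, not in `X`, is interesting under `X` for its firm `f`. -/
def InterestingF (X : Finset (W × F)) (e : W × F) : Prop :=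
  e ∈ M.E \ X ∧ e ∈ M.choice e.2 (insert e (M.atF X e.2))

/-- Stable matchings: the acceptable ones which are not blocked by any edge. -/
def Stable (X : Finset (W × F)) : Prop :=
  M.Acceptable X ∧ ∀ e ∈ M.E \ X, ¬ (M.InterestingW X e ∧ M.InterestingF X e)

/-- `X ⪯ Y` (for acceptable matchings): every firm `f` weakly prefers `Y_f` to `X_f`, that is,
`C_f (Y_f ∪ X_f) = Y_f`. -/
def PrecEq (X Y : Finset (W × F)) : Prop :=
  ∀ f, M.choice f (M.atF Y f ∪ M.atF X f) = M.atF Y f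

/-- `X ≺ Y` (for acceptable matchings). -/
def Prec (X Y : Finset (W × F)) : Prop := X ≠ Y ∧ M.PrecEq X Y

/-- The edges `e = wf` such that `w` is fully filled with `X_w = {x_w}`, `x_w >_w e`, and `e` is
interesting for `f` under `X`. -/
def IsCandidate (X : Finset (W × F)) (e : W × F) : Prop :=
  e ∈ M.E ∧ (∃ x, M.atW X e.1 = {x} ∧ M.gt e.1 x e) ∧ M.InterestingF X e

/-- `e = wf` is the `W`-admissible edge `a_w` for `X`: the most preferred candidate at `w`. -/
def IsWAdmissible (X : Finset (W × F)) (e : W × F) : Prop :=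
  M.IsCandidate X e ∧ ∀ e', M.IsCandidate X e' → e'.1 = e.1 → e' ≠ e → M.gt e.1 e e'

/-- `(a, b)` is a tandem for `X`, passing the firm `f = a.2`: `a` is a `W`-admissible edge and
`b` is the edge of `X_f` such that `C_f (X_f + a) = X_f + a - b`. -/
def IsTandem (X : Finset (W × F)) (a b : W × F) : Prop :=
  M.IsWAdmissible X a ∧ b ∈ M.atF X a.2 ∧
    M.choice a.2 (insert a (M.atF X a.2)) = insert a ((M.atF X a.2).erase b)

open Classical in
/-- The digraph `D(X)` formed by all `W`-admissible edges, directed from `W` to `F`, and all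
`F`-admissible edges (those associated with a `W`-admissible edge), directed from `F` to `W`. -/
noncomputable def admissibleGraph (X : Finset (W × F)) : BipDigraph W F where
  toF := M.E.filter (fun a => M.IsWAdmissible X a)
  toW := M.E.filter (fun b => ∃ a, M.IsTandem X a b)

open Classical in
/-- The graph obtained from `D` by deleting its edge `a`, directed from `W` to `F`, together with
the edge associated with `a` (if it exists) when that edge occurs in no other tandem of `D`. -/
noncomputable def removeEdge (X : Finset (W × F)) (D : BipDigraph W F) (a : W × F) :
    BipDigraph W F where
  toF := D.toF.erase a
  toW := D.toW.filter
    (fun b => ¬ (M.IsTandem X a b ∧ ∀ a' ∈ D.toF, a' ≠ a → ¬ M.IsTandem X a' b))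

/-- One step of the cleaning procedure: for some worker `w` with a leaving edge `a = a_w` but no
entering edge in the current graph `D`, the edge `a` is removed as described above. -/
def CleaningStep (X : Finset (W × F)) (D D' : BipDigraph W F) : Prop :=
  ∃ a ∈ D.toF, D.inW a.1 = ∅ ∧ D' = M.removeEdge X D a

/-- `Γ` is a result of the cleaning procedure: it is reached from `D(X)` by cleaning steps, and
no further cleaning step is possible. -/
def IsCleaned (X : Finset (W × F)) (Γ : BipDigraph W F) : Prop :=
  Relation.ReflTransGen (M.CleaningStep X) (M.admissibleGraph X) Γ ∧
    ∀ D', ¬ M.CleaningStep X Γ D'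

/-- The cleaning procedure terminates. -/
theorem exists_isCleaned (X : Finset (W × F)) : ∃ Γ, M.IsCleaned X Γ := by
  have key : ∀ (n : ℕ) (D : BipDigraph W F), D.toF.card = n →
      Relation.ReflTransGen (M.CleaningStep X) (M.admissibleGraph X) D →
      ∃ Γ, M.IsCleaned X Γ := by
    intro n
    induction n using Nat.strong_induction_on with
    | _ n ih =>
      intro D hn hD
      by_cases h : ∃ D', M.CleaningStep X D D'
      · obtain ⟨D', hs⟩ := h
        have hs' := hs
        obtain ⟨a, ha, -, rfl⟩ := hs'
        refine ih _ ?_ _ rfl (hD.tail hs)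
        rw [← hn]
        exact Finset.card_erase_lt_of_mem ha
      · exact ⟨D, hD, fun D' hs => h ⟨D', hs⟩⟩
  exact key _ _ rfl Relation.ReflTransGen.refl

/-- In all graphs that arise, the edges directed to `W` are those associated with the present
edges directed to `F`. -/
theorem mem_toW_iff_of_reachable (X : Finset (W × F)) (D : BipDigraph W F)
    (hD : Relation.ReflTransGen (M.CleaningStep X) (M.admissibleGraph X) D) (b : W × F) :
    b ∈ D.toW ↔ ∃ a ∈ D.toF, M.IsTandem X a b := by
  induction hD with
  | refl =>
    simp only [admissibleGraph, Finset.mem_filter]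
    constructor
    · rintro ⟨-, a, ha⟩
      exact ⟨a, ⟨ha.1.1.1, ha.1⟩, ha⟩
    · rintro ⟨a, -, ha⟩
      have hb := ha.2.1
      simp only [atF, Finset.mem_inter, Finset.mem_filter] at hb
      exact ⟨hb.2.1, a, ha⟩
  | tail _ hs ih =>
    obtain ⟨a, ha, -, rfl⟩ := hs
    simp only [removeEdge, Finset.mem_filter]
    rw [ih]
    constructor
    · rintro ⟨⟨a', ha', ht⟩, hn⟩
      by_cases h : a' = a
      · subst h
        by_contra hc
        refine hn ⟨ht, fun a'' h1 h2 h3 => hc ⟨a'', Finset.mem_erase.2 ⟨h2, h1⟩, h3⟩⟩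
      · exact ⟨a', Finset.mem_erase.2 ⟨h, ha'⟩, ht⟩
    · rintro ⟨a', ha', ht⟩
      obtain ⟨h1, h2⟩ := Finset.mem_erase.1 ha'
      exact ⟨⟨a', h2, ht⟩, fun h => h.2 a' h2 h1 ht⟩

/-- The result of the cleaning procedure does not depend on the order of the steps. -/
theorem IsCleaned.unique {X : Finset (W × F)} {Γ Γ' : BipDigraph W F}
    (h : M.IsCleaned X Γ) (h' : M.IsCleaned X Γ') : Γ = Γ' := by
  have key : ∀ {T : BipDigraph W F}, M.IsCleaned X T → ∀ {D : BipDigraph W F},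
      Relation.ReflTransGen (M.CleaningStep X) (M.admissibleGraph X) D → T.toF ⊆ D.toF := by
    intro T hT D hD
    induction hD with
    | refl =>
      have : ∀ D, Relation.ReflTransGen (M.CleaningStep X) (M.admissibleGraph X) D →
          D.toF ⊆ (M.admissibleGraph X).toF := by
        intro D hD
        induction hD with
        | refl => exact Finset.Subset.refl _
        | tail _ hs ih =>
          obtain ⟨a, -, -, rfl⟩ := hs
          exact (Finset.erase_subset _ _).trans ih
      exact this T hT.1
    | tail hD hs ih =>
      obtain ⟨a, ha, hin, rfl⟩ := hs
      refine Finset.subset_erase.2 ⟨ih, fun haT => ?_⟩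
      by_cases hinT : T.inW a.1 = ∅
      · exact hT.2 _ ⟨a, haT, hinT, rfl⟩
      · obtain ⟨b, hb⟩ := Finset.nonempty_iff_ne_empty.2 hinT
        obtain ⟨hb, hb1⟩ := Finset.mem_filter.1 hb
        obtain ⟨a', ha', ht⟩ := (M.mem_toW_iff_of_reachable X _ hT.1 b).1 hb
        have : b ∈ BipDigraph.inW _ a.1 := Finset.mem_filter.2
          ⟨(M.mem_toW_iff_of_reachable X _ hD b).2 ⟨a', ih ha', ht⟩, hb1⟩
        rw [hin] at this
        exact absurd this (Finset.notMem_empty b)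
  have hF : Γ.toF = Γ'.toF := Finset.Subset.antisymm (key h h'.1) (key h' h.1)
  refine BipDigraph.ext hF (Finset.ext fun b => ?_)
  rw [M.mem_toW_iff_of_reachable X _ h.1, M.mem_toW_iff_of_reachable X _ h'.1, hF]

/-- The active graph `Γ(X)`: the result of the cleaning procedure applied to `D(X)`. -/
noncomputable def activeGraph (X : Finset (W × F)) : BipDigraph W F :=
  Classical.choose (M.exists_isCleaned X)

/-- `(Lp, Lm)` is the pair `(L⁺, L⁻)` of a rotation `L` generated by `X`. Here `L` is a directed
cycle of the active graph in which the edges `a 0, b 0, a 1, b 1, …, a n, b n` occur in this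
cyclic order (`i + 1` is taken modulo `n + 1`) and are all different; `a i` is directed from `W`
to `F` and `b i` from `F` to `W`; each pair `(a i, b i)` forms a tandem (passing the firm at
which `a i` enters), and `b i`, `a (i + 1)` are the unique edges of the active graph entering,
resp. leaving, the next worker of the cycle. -/
def IsRotation (X Lp Lm : Finset (W × F)) : Prop :=
  ∃ (n : ℕ) (a b : Fin (n + 1) → W × F),
    Function.Injective a ∧ Function.Injective b ∧
    (∀ i, M.IsTandem X (a i) (b i)) ∧
    (∀ i, (M.activeGraph X).inW (a (i + 1)).1 = {b i} ∧
      (M.activeGraph X).outW (a (i + 1)).1 = {a (i + 1)}) ∧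
    Lp = Finset.univ.image a ∧ Lm = Finset.univ.image b

/-- `𝒮_X`: the set of matchings `X' = (X - L⁻) ∪ L⁺` obtained from `X` by applying a rotation `L`
generated by `X`. -/
def rotated (X : Finset (W × F)) : Set (Finset (W × F)) :=
  {X' | ∃ Lp Lm, M.IsRotation X Lp Lm ∧ X' = (X \ Lm) ∪ Lp}

end CBModel

/-!
For stable `X ≺ Y`, every edge of `Y \ X` is interesting for its firm under `X`, so by stability
its worker is filled by `X` and prefers its edge in `X` to it. Counting edges on both sides, cardinal
monotonicity then gives `|X_f| = |Y_f|` at every firm (`Stable.card_atF_eq`).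

Let `w` be a worker with `X_w ≠ Y_w`. Then `a_w` exists and `w` weakly prefers it to its edge in
`Y`, so stability of `Y` yields `C_f (X_f ∪ Y_f + a_w) = Y_f` at the firm `f` of `a_w`. Hence
`C_f (X_f + a_w)` has exactly `|X_f|` elements, so an edge `b` associated with `a_w` exists, and by
substitutability `b ∉ Y`. The worker of `b` is therefore again one at which `X` and `Y` differ
(`Stable.exists_tandem_of_atW_ne`). Passing from `w` to the worker of `b` is a self-map of a finite
nonempty set; a periodic orbit of it is a directed cycle of tandems, no edge of which is ever
deleted by the cleaning procedure, that is, a rotation (`Stable.exists_isRotation`).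

Applying any rotation to `X` produces a stable matching `X'` with `X ≺ X'`: substitutability
excludes the removed edges from `C_f (X_f ∪ L⁺_f)`, and cardinal monotonicity leaves no room for
losing anything else (`IsRotation.choice_union`); an edge blocking `X'` would be a candidate at its
worker `w`, hence not better than `a_w` (`IsRotation.stable`). For the rotation found above,
`X' ⪯ Y` because adding the edges of `L⁺` to `X_f ∪ Y_f` does not change the choice `Y_f`. The set of
edges that are worse than the matching for their worker shrinks strictly, so iterating the
construction reaches `Y`.
-/

namespace CBModel

variable {W F : Type*} [DecidableEq W] [DecidableEq F] {M : CBModel W F}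
  {X Y X' Lp Lm : Finset (W × F)}

/-! ### Choice functions and acceptable matchings -/

lemma mem_atW {w : W} {e : W × F} : e ∈ M.atW X w ↔ e ∈ X ∧ e ∈ M.E ∧ e.1 = w := by
  simp [atW]

lemma mem_atF {f : F} {e : W × F} : e ∈ M.atF X f ↔ e ∈ X ∧ e ∈ M.E ∧ e.2 = f := by
  simp [atF]

lemma atF_subset (f : F) : M.atF X f ⊆ M.E.filter (fun e => e.2 = f) :=
  Finset.inter_subset_right

lemma insert_atF_subset {e : W × F} (he : e ∈ M.E) {f : F} (hf : e.2 = f)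
    {Z : Finset (W × F)} (hZ : Z ⊆ M.E.filter (fun e => e.2 = f)) :
    insert e Z ⊆ M.E.filter (fun e => e.2 = f) :=
  Finset.insert_subset (Finset.mem_filter.2 ⟨he, hf⟩) hZ

/-- Elements that are not chosen may be discarded one at a time. -/
lemma choice_insert_of_notMem {f : F} {e : W × F} {Z : Finset (W × F)}
    (hZ : insert e Z ⊆ M.E.filter (fun e => e.2 = f)) (he : e ∉ M.choice f (insert e Z)) :
    M.choice f (insert e Z) = M.choice f Z := by
  refine (M.choice_consistent f _ hZ Z (Finset.subset_insert _ _) fun x hx => ?_).symm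
  rcases Finset.mem_insert.1 (M.choice_subset f _ hZ hx) with rfl | h
  · exact absurd hx he
  · exact h

lemma gt_asymm {e e' : W × F} {w : W} (he : e ∈ M.E) (he' : e' ∈ M.E) (hw : e.1 = w)
    (hw' : e'.1 = w) (h : M.gt w e e') : ¬ M.gt w e' e := fun h' =>
  M.gt_irrefl w e he hw (M.gt_trans w e he e' he' e he hw hw' hw h h')

lemma Acceptable.eq_of_mem_atW (hX : M.Acceptable X) {w : W} {e e' : W × F}
    (he : e ∈ M.atW X w) (he' : e' ∈ M.atW X w) : e = e' := by
  by_contra hne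
  have h1 : e ∈ M.choiceW w (M.atW X w) := (hX.2.1 w).symm ▸ he
  have h2 : e' ∈ M.choiceW w (M.atW X w) := (hX.2.1 w).symm ▸ he'
  simp only [choiceW, Finset.mem_filter] at h1 h2
  have a1 := mem_atW.1 he
  have a2 := mem_atW.1 he'
  exact gt_asymm a1.2.1 a2.2.1 a1.2.2 a2.2.2 (h1.2 e' he' (Ne.symm hne)) (h2.2 e he hne)

lemma Acceptable.atW_eq_singleton (hX : M.Acceptable X) {w : W} {e : W × F}
    (he : e ∈ M.atW X w) : M.atW X w = {e} :=
  Finset.eq_singleton_iff_unique_mem.2 ⟨he, fun _ h => hX.eq_of_mem_atW h he⟩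

lemma Acceptable.injOn_fst (hX : M.Acceptable X) : Set.InjOn Prod.fst (X : Set (W × F)) :=
  fun e he _ he' h => hX.eq_of_mem_atW (w := e.1) (mem_atW.2 ⟨he, hX.1 he, rfl⟩)
    (mem_atW.2 ⟨he', hX.1 he', h.symm⟩)

/-! ### Candidates and admissible edges -/

lemma not_interestingW_iff_exists_gt {e : W × F} (he : e ∈ M.E \ X) :
    ¬ M.InterestingW X e ↔ ∃ x ∈ M.atW X e.1, M.gt e.1 x e := by
  obtain ⟨heE, heX⟩ := Finset.mem_sdiff.1 he
  simp only [InterestingW, choiceW, Finset.mem_filter, he, true_and, Finset.mem_insert_self,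
    not_forall]
  constructor
  · rintro ⟨x, hx, hne, hgt⟩
    have hx := (Finset.mem_insert.1 hx).resolve_left hne
    have hx' := mem_atW.1 hx
    exact ⟨x, hx, ((M.gt_total e.1 x hx'.2.1 e heE hx'.2.2 rfl).resolve_left hne).resolve_right hgt⟩
  · rintro ⟨x, hx, hgt⟩
    have hx' := mem_atW.1 hx
    exact ⟨x, Finset.mem_insert_of_mem hx, fun h => heX (h ▸ hx'.1),
      gt_asymm hx'.2.1 heE hx'.2.2 rfl hgt⟩

lemma Stable.isCandidate (hX : M.Stable X) {e : W × F} (he : M.InterestingF X e) :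
    M.IsCandidate X e := by
  obtain ⟨x, hx, hgt⟩ := (not_interestingW_iff_exists_gt he.1).1 fun h => hX.2 e he.1 ⟨h, he⟩
  exact ⟨(Finset.mem_sdiff.1 he.1).1, ⟨x, hX.1.atW_eq_singleton hx, hgt⟩, he⟩

lemma exists_gt_forall_of_nonempty (w : W) (S : Finset (W × F)) (hS : S.Nonempty)
    (hSE : ∀ e ∈ S, e ∈ M.E ∧ e.1 = w) : ∃ m ∈ S, ∀ e ∈ S, e ≠ m → M.gt w m e := by
  induction hS using Finset.Nonempty.cons_induction with
  | singleton a => exact ⟨a, by simp, by simp⟩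
  | cons a S ha hS ih =>
    obtain ⟨m, hm, hmax⟩ := ih fun e he => hSE e (Finset.mem_cons_of_mem he)
    have haE := hSE a (Finset.mem_cons_self a S)
    have hmE := hSE m (Finset.mem_cons_of_mem hm)
    rcases M.gt_total w a haE.1 m hmE.1 haE.2 hmE.2 with rfl | h | h
    · exact absurd hm ha
    · refine ⟨a, Finset.mem_cons_self a S, fun e he hne => ?_⟩
      have he := (Finset.mem_cons.1 he).resolve_left hne
      by_cases hem : e = m
      · exact hem ▸ h
      · have heE := hSE e (Finset.mem_cons_of_mem he)
        exact M.gt_trans w a haE.1 m hmE.1 e heE.1 haE.2 hmE.2 heE.2 h (hmax e he hem)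
    · refine ⟨m, Finset.mem_cons_of_mem hm, fun e he hne => ?_⟩
      rcases Finset.mem_cons.1 he with rfl | he
      · exact h
      · exact hmax e he hne

lemma IsCandidate.exists_isWAdmissible {e : W × F} (he : M.IsCandidate X e) :
    ∃ a, a.1 = e.1 ∧ M.IsWAdmissible X a := by
  classical
  obtain ⟨a, ha, hmax⟩ := exists_gt_forall_of_nonempty (M := M) e.1
    (M.E.filter fun e' => e'.1 = e.1 ∧ M.IsCandidate X e') ⟨e, by simp [he, he.1]⟩
    fun e' he' => by
      simp only [Finset.mem_filter] at he'
      exact ⟨he'.1, he'.2.1⟩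
  simp only [Finset.mem_filter] at ha hmax
  exact ⟨a, ha.2.1, ha.2.2, fun e' hc h hne =>
    ha.2.1.symm ▸ hmax e' ⟨hc.1, h.trans ha.2.1, hc⟩ hne⟩

lemma IsWAdmissible.mem_E {a : W × F} (ha : M.IsWAdmissible X a) : a ∈ M.E := ha.1.1

lemma IsWAdmissible.notMem {a : W × F} (ha : M.IsWAdmissible X a) : a ∉ X :=
  (Finset.mem_sdiff.1 ha.1.2.2.1).2

lemma IsWAdmissible.eq_of_fst_eq {a a' : W × F} (ha : M.IsWAdmissible X a)
    (ha' : M.IsWAdmissible X a') (h : a.1 = a'.1) : a = a' := by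
  by_contra hne
  refine gt_asymm ha.mem_E ha'.mem_E h rfl ?_ (ha'.2 a ha.1 h hne)
  exact h ▸ ha.2 a' ha'.1 h.symm (Ne.symm hne)

lemma IsTandem.snd_eq {a b : W × F} (h : M.IsTandem X a b) : b.2 = a.2 := (mem_atF.1 h.2.1).2.2

lemma IsTandem.mem {a b : W × F} (h : M.IsTandem X a b) : b ∈ X := (mem_atF.1 h.2.1).1

lemma IsTandem.mem_E {a b : W × F} (h : M.IsTandem X a b) : b ∈ M.E := (mem_atF.1 h.2.1).2.1

lemma IsTandem.notMem_choice {a b : W × F} (h : M.IsTandem X a b) :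
    b ∉ M.choice a.2 (insert a (M.atF X a.2)) := by
  rw [h.2.2, Finset.mem_insert, not_or]
  exact ⟨fun hb => h.1.notMem (hb ▸ h.mem), Finset.notMem_erase _ _⟩

/-! ### The active graph -/

/-- Admissible edges that supply one another with edges entering their workers are never deleted. -/
lemma mem_toF_of_reachable {D : BipDigraph W F} {S : Set (W × F)}
    (hS : ∀ a ∈ S, M.IsWAdmissible X a)
    (hin : ∀ a ∈ S, ∃ a' ∈ S, ∃ b, M.IsTandem X a' b ∧ b.1 = a.1)
    (hD : Relation.ReflTransGen (M.CleaningStep X) (M.admissibleGraph X) D) :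
    ∀ a ∈ S, a ∈ D.toF := by
  classical
  induction hD with
  | refl => exact fun a ha => Finset.mem_filter.2 ⟨(hS a ha).mem_E, hS a ha⟩
  | tail hD hs ih =>
    obtain ⟨a₀, -, hempty, rfl⟩ := hs
    refine fun a ha => Finset.mem_erase.2 ⟨?_, ih a ha⟩
    rintro rfl
    obtain ⟨a', ha', b, ht, hb⟩ := hin a ha
    have : b ∈ BipDigraph.inW _ a.1 := Finset.mem_filter.2
      ⟨(M.mem_toW_iff_of_reachable X _ hD b).2 ⟨a', ih a' ha', ht⟩, hb⟩
    exact absurd (hempty ▸ this) (Finset.notMem_empty b)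

lemma activeGraph_reachable (M : CBModel W F) (X : Finset (W × F)) :
    Relation.ReflTransGen (M.CleaningStep X) (M.admissibleGraph X) (M.activeGraph X) :=
  (Classical.choose_spec (M.exists_isCleaned X)).1

lemma isWAdmissible_of_mem_toF {D : BipDigraph W F}
    (hD : Relation.ReflTransGen (M.CleaningStep X) (M.admissibleGraph X) D) :
    ∀ a ∈ D.toF, M.IsWAdmissible X a := by
  classical
  induction hD with
  | refl => exact fun a ha => (Finset.mem_filter.1 ha).2
  | tail _ hs ih =>
    obtain ⟨a₀, -, -, rfl⟩ := hs
    exact fun a ha => ih a (Finset.mem_of_mem_erase ha)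

/-- A cyclic sequence of tandems in which each edge entering a worker is followed by the admissible
edge leaving it survives the cleaning procedure. -/
lemma isRotation_of_cycle (hX : M.Acceptable X) {n : ℕ} {a b : Fin (n + 1) → W × F}
    (ha : Function.Injective a) (ht : ∀ i, M.IsTandem X (a i) (b i))
    (hab : ∀ i, (b i).1 = (a (i + 1)).1) :
    M.IsRotation X (Finset.univ.image a) (Finset.univ.image b) := by
  have hG := M.activeGraph_reachable X
  have hmem : ∀ i, a i ∈ (M.activeGraph X).toF := fun i =>
    mem_toF_of_reachable (S := Set.range a) (by rintro _ ⟨i, rfl⟩; exact (ht i).1)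
      (by
        rintro _ ⟨i, rfl⟩
        exact ⟨a (i - 1), ⟨_, rfl⟩, b (i - 1), ht _, by rw [hab, sub_add_cancel]⟩)
      hG _ ⟨i, rfl⟩
  refine ⟨n, a, b, ha, fun i j hij => ?_, ht, fun i => ⟨?_, ?_⟩, rfl, rfl⟩
  · have h := (ht (i + 1)).1.eq_of_fst_eq (ht (j + 1)).1 (by rw [← hab, ← hab, hij])
    exact add_right_cancel (ha h)
  · refine Finset.eq_singleton_iff_unique_mem.2 ⟨Finset.mem_filter.2
      ⟨(M.mem_toW_iff_of_reachable X _ hG _).2 ⟨a i, hmem i, ht i⟩, hab i⟩, fun e he => ?_⟩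
    obtain ⟨he, hw⟩ := Finset.mem_filter.1 he
    obtain ⟨a', -, h⟩ := (M.mem_toW_iff_of_reachable X _ hG e).1 he
    exact hX.injOn_fst h.mem (ht i).mem (hw.trans (hab i).symm)
  · refine Finset.eq_singleton_iff_unique_mem.2 ⟨Finset.mem_filter.2 ⟨hmem _, rfl⟩, fun e he => ?_⟩
    obtain ⟨he, hw⟩ := Finset.mem_filter.1 he
    exact (isWAdmissible_of_mem_toF hG e he).eq_of_fst_eq (ht _).1 hw

/-! ### Applying a rotation -/

lemma IsRotation.isWAdmissible (h : M.IsRotation X Lp Lm) {e : W × F} (he : e ∈ Lp) :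
    M.IsWAdmissible X e := by
  obtain ⟨n, a, b, -, -, ht, -, rfl, rfl⟩ := h
  obtain ⟨i, -, rfl⟩ := Finset.mem_image.1 he
  exact (ht i).1

lemma IsRotation.exists_isTandem (h : M.IsRotation X Lp Lm) {e : W × F} (he : e ∈ Lm) :
    ∃ a ∈ Lp, M.IsTandem X a e := by
  obtain ⟨n, a, b, -, -, ht, -, rfl, rfl⟩ := h
  obtain ⟨i, -, rfl⟩ := Finset.mem_image.1 he
  exact ⟨a i, Finset.mem_image_of_mem _ (Finset.mem_univ i), ht i⟩

lemma IsRotation.nonempty (h : M.IsRotation X Lp Lm) : Lp.Nonempty := by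
  obtain ⟨n, a, b, -, -, -, -, rfl, rfl⟩ := h
  exact ⟨a 0, Finset.mem_image_of_mem _ (Finset.mem_univ 0)⟩

lemma IsRotation.exists_mem_fst_eq (h : M.IsRotation X Lp Lm) {e : W × F} (he : e ∈ Lp) :
    ∃ b ∈ Lm, b.1 = e.1 := by
  obtain ⟨n, a, b, -, -, -, hc, rfl, rfl⟩ := h
  obtain ⟨i, -, rfl⟩ := Finset.mem_image.1 he
  have hb : b (i - 1) ∈ (M.activeGraph X).inW (a (i - 1 + 1)).1 :=
    (hc (i - 1)).1 ▸ Finset.mem_singleton_self _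
  rw [sub_add_cancel] at hb
  exact ⟨b (i - 1), Finset.mem_image_of_mem _ (Finset.mem_univ _), (Finset.mem_filter.1 hb).2⟩

lemma IsRotation.exists_fst_mem (h : M.IsRotation X Lp Lm) {b : W × F} (hb : b ∈ Lm) :
    ∃ e ∈ Lp, b.1 = e.1 := by
  obtain ⟨n, a, b, -, -, -, hc, rfl, rfl⟩ := h
  obtain ⟨i, -, rfl⟩ := Finset.mem_image.1 hb
  have hb : b i ∈ (M.activeGraph X).inW (a (i + 1)).1 := (hc i).1 ▸ Finset.mem_singleton_self _
  exact ⟨a (i + 1), Finset.mem_image_of_mem _ (Finset.mem_univ _), (Finset.mem_filter.1 hb).2⟩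

/-- A rotation enters and leaves each firm equally often. -/
lemma IsRotation.card_filter_snd (h : M.IsRotation X Lp Lm) (f : F) :
    (Lp.filter fun e => e.2 = f).card = (Lm.filter fun e => e.2 = f).card := by
  obtain ⟨n, a, b, ha, hb, ht, -, rfl, rfl⟩ := h
  simp only [Finset.filter_image]
  rw [Finset.card_image_of_injective _ ha, Finset.card_image_of_injective _ hb]
  simp only [(ht _).snd_eq]

/-- Firms passed several times by a rotation accept all its exchanges simultaneously. -/
lemma IsRotation.choice_union (hX : M.Acceptable X) (h : M.IsRotation X Lp Lm) (f : F) :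
    M.choice f (M.atF X f ∪ M.atF Lp f) = M.atF ((X \ Lm) ∪ Lp) f := by
  have hZ : M.atF X f ∪ M.atF Lp f ⊆ M.E.filter (fun e => e.2 = f) :=
    Finset.union_subset (atF_subset f) (atF_subset f)
  have hsub : M.choice f (M.atF X f ∪ M.atF Lp f) ⊆ M.atF ((X \ Lm) ∪ Lp) f := by
    intro e he
    have heZ := M.choice_subset f _ hZ he
    obtain ⟨heE, hef⟩ := Finset.mem_filter.1 (hZ heZ)
    refine mem_atF.2 ⟨?_, heE, hef⟩
    rcases Finset.mem_union.1 heZ with hx | hx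
    · refine Finset.mem_union_left _ (Finset.mem_sdiff.2 ⟨(mem_atF.1 hx).1, fun hm => ?_⟩)
      obtain ⟨a, ha, ht⟩ := h.exists_isTandem hm
      have haf : a.2 = f := ht.snd_eq.symm.trans hef
      subst haf
      refine ht.notMem_choice (M.choice_substitutable a.2 _ hZ _ (Finset.insert_subset
        (Finset.mem_union_right _ (mem_atF.2 ⟨ha, ht.1.mem_E, rfl⟩)) Finset.subset_union_left)
        (Finset.mem_inter.2 ⟨he, Finset.mem_insert_of_mem hx⟩))
    · exact Finset.mem_union_right _ (mem_atF.1 hx).1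
  refine Finset.eq_of_subset_of_card_le hsub ?_
  have h1 : (M.atF X f).card ≤ (M.choice f (M.atF X f ∪ M.atF Lp f)).card := by
    have := M.choice_card_mono f _ hZ _ (Finset.subset_union_left (s₁ := M.atF X f))
    rwa [hX.2.2 f] at this
  refine le_trans ?_ h1
  have h2 : M.atF ((X \ Lm) ∪ Lp) f ⊆
      (M.atF X f \ Lm.filter fun e => e.2 = f) ∪ Lp.filter fun e => e.2 = f := by
    intro e he
    simp only [mem_atF, Finset.mem_union, Finset.mem_sdiff, Finset.mem_filter] at he ⊢
    tauto
  have h3 : (Lm.filter fun e => e.2 = f) ⊆ M.atF X f := by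
    intro e he
    obtain ⟨he, hf⟩ := Finset.mem_filter.1 he
    obtain ⟨a, -, ht⟩ := h.exists_isTandem he
    exact mem_atF.2 ⟨ht.mem, ht.mem_E, hf⟩
  calc _ ≤ _ := Finset.card_le_card h2
    _ ≤ _ := Finset.card_union_le _ _
    _ = (M.atF X f).card := by
      rw [h.card_filter_snd f, Finset.card_sdiff_add_card_eq_card h3]

lemma IsRotation.precEq (hX : M.Acceptable X) (h : M.IsRotation X Lp Lm) :
    M.PrecEq X ((X \ Lm) ∪ Lp) := by
  intro f
  convert h.choice_union hX f using 2
  ext e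
  simp only [mem_atF, Finset.mem_union, Finset.mem_sdiff]
  tauto

lemma IsRotation.prec (hX : M.Acceptable X) (h : M.IsRotation X Lp Lm) :
    M.Prec X ((X \ Lm) ∪ Lp) := by
  refine ⟨fun heq => ?_, h.precEq hX⟩
  obtain ⟨a, ha⟩ := h.nonempty
  exact (h.isWAdmissible ha).notMem (heq ▸ Finset.mem_union_right _ ha)

lemma IsRotation.atW_of_mem (hX : M.Acceptable X) (h : M.IsRotation X Lp Lm) {a : W × F}
    (ha : a ∈ Lp) : M.atW ((X \ Lm) ∪ Lp) a.1 = {a} := by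
  refine Finset.eq_singleton_iff_unique_mem.2 ⟨mem_atW.2
    ⟨Finset.mem_union_right _ ha, (h.isWAdmissible ha).mem_E, rfl⟩, fun e he => ?_⟩
  obtain ⟨he, -, hw⟩ := mem_atW.1 he
  rcases Finset.mem_union.1 he with he | he
  · obtain ⟨he, hm⟩ := Finset.mem_sdiff.1 he
    obtain ⟨b, hb, hbw⟩ := h.exists_mem_fst_eq ha
    obtain ⟨_, -, ht⟩ := h.exists_isTandem hb
    exact absurd (hX.injOn_fst he ht.mem (hw.trans hbw.symm) ▸ hb) hm
  · exact (h.isWAdmissible he).eq_of_fst_eq (h.isWAdmissible ha) hw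

lemma IsRotation.atW_of_forall_ne (h : M.IsRotation X Lp Lm) {w : W}
    (hw : ∀ a ∈ Lp, a.1 ≠ w) : M.atW ((X \ Lm) ∪ Lp) w = M.atW X w := by
  ext e
  simp only [mem_atW, Finset.mem_union, Finset.mem_sdiff]
  constructor
  · rintro ⟨he | he, hE, hew⟩
    · exact ⟨he.1, hE, hew⟩
    · exact absurd hew (hw e he)
  · rintro ⟨he, hE, hew⟩
    refine ⟨Or.inl ⟨he, fun hm => ?_⟩, hE, hew⟩
    obtain ⟨a, ha, haw⟩ := h.exists_fst_mem hm
    exact hw a ha (haw.symm.trans hew)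

lemma IsRotation.acceptable (hX : M.Acceptable X) (h : M.IsRotation X Lp Lm) :
    M.Acceptable ((X \ Lm) ∪ Lp) := by
  refine ⟨fun e he => ?_, fun w => ?_, fun f => ?_⟩
  · rcases Finset.mem_union.1 he with he | he
    · exact hX.1 (Finset.mem_sdiff.1 he).1
    · exact (h.isWAdmissible he).mem_E
  · by_cases hw : ∃ a ∈ Lp, a.1 = w
    · obtain ⟨a, ha, rfl⟩ := hw
      rw [h.atW_of_mem hX ha]
      ext e
      simp +contextual [choiceW, eq_comm]
    · rw [h.atW_of_forall_ne fun a ha hc => hw ⟨a, ha, hc⟩]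
      exact hX.2.1 w
  · have hp := h.precEq hX f
    have := M.choice_consistent f _ (Finset.union_subset (atF_subset f) (atF_subset f)) _
      (Finset.subset_union_left (s₁ := M.atF ((X \ Lm) ∪ Lp) f) (s₂ := M.atF X f)) hp.subset
    exact this.trans hp

/-- As the firms become better off, they lose interest in edges, and never regain it. -/
lemma PrecEq.interestingF (h : M.PrecEq X X') {e : W × F} (he : M.InterestingF X' e) :
    M.InterestingF X e := by
  obtain ⟨heX', hec⟩ := he
  obtain ⟨heE, heX'⟩ := Finset.mem_sdiff.1 heX'
  have hU : M.atF X' e.2 ∪ M.atF X e.2 ⊆ M.E.filter (fun e' => e'.2 = e.2) :=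
    Finset.union_subset (atF_subset _) (atF_subset _)
  have hIU := insert_atF_subset heE rfl hU
  have hin : e ∈ M.choice e.2 (insert e (M.atF X' e.2 ∪ M.atF X e.2)) := by
    by_contra hne
    have h1 := (choice_insert_of_notMem hIU hne).trans (h e.2)
    have h2 := M.choice_consistent e.2 _ hIU (insert e (M.atF X' e.2))
      (Finset.insert_subset_insert _ Finset.subset_union_left)
      (h1.subset.trans (Finset.subset_insert _ _))
    exact hne (h2 ▸ hec)
  refine ⟨Finset.mem_sdiff.2 ⟨heE, fun heX => ?_⟩, ?_⟩
  · rw [Finset.insert_eq_of_mem (Finset.mem_union_right _ (mem_atF.2 ⟨heX, heE, rfl⟩)), h e.2] at hin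
    exact heX' (mem_atF.1 hin).1
  · exact M.choice_substitutable e.2 _ hIU _
      (Finset.insert_subset_insert _ Finset.subset_union_right)
      (Finset.mem_inter.2 ⟨hin, Finset.mem_insert_self _ _⟩)

/-- An edge blocking the new matching already interests its firm under `X`, so it is a candidate at
its worker, who now holds the best candidate or an edge preferred to all of them. -/
lemma IsRotation.stable (hX : M.Stable X) (h : M.IsRotation X Lp Lm) :
    M.Stable ((X \ Lm) ∪ Lp) := by
  refine ⟨h.acceptable hX.1, fun e he hb => ?_⟩
  have hc := hX.isCandidate ((h.precEq hX.1).interestingF hb.2)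
  refine (not_interestingW_iff_exists_gt he).2 ?_ hb.1
  by_cases hw : ∃ a ∈ Lp, a.1 = e.1
  · obtain ⟨a, ha, haw⟩ := hw
    refine ⟨a, ?_, haw ▸ (h.isWAdmissible ha).2 e hc haw.symm ?_⟩
    · rw [← haw, h.atW_of_mem hX.1 ha]
      exact Finset.mem_singleton_self a
    · rintro rfl
      exact (Finset.mem_sdiff.1 he).2 (Finset.mem_union_right _ ha)
  · rw [h.atW_of_forall_ne fun a ha hc => hw ⟨a, ha, hc⟩]
    obtain ⟨x, hx, hgt⟩ := hc.2.1
    exact ⟨x, hx ▸ Finset.mem_singleton_self x, hgt⟩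

open Classical in
/-- The edges `e = wf` such that `w` prefers its edge in `X` to `e`. -/
noncomputable def dominated (M : CBModel W F) (X : Finset (W × F)) : Finset (W × F) :=
  M.E.filter fun e => ∃ x ∈ M.atW X e.1, M.gt e.1 x e

lemma IsRotation.dominated_ssubset (hX : M.Acceptable X) (h : M.IsRotation X Lp Lm) :
    M.dominated ((X \ Lm) ∪ Lp) ⊂ M.dominated X := by
  classical
  refine (Finset.ssubset_iff_of_subset fun e he => ?_).2 ?_
  · obtain ⟨heE, x', hx', hgt⟩ := Finset.mem_filter.1 he
    refine Finset.mem_filter.2 ⟨heE, ?_⟩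
    by_cases hw : ∃ a ∈ Lp, a.1 = e.1
    · obtain ⟨a, ha, haw⟩ := hw
      rw [← haw, h.atW_of_mem hX ha] at hx'
      obtain rfl := Finset.mem_singleton.1 hx'
      obtain ⟨haE, ⟨x, hx, hxa⟩, -⟩ := (h.isWAdmissible ha).1
      rw [haw] at hx hxa
      have hx : x ∈ M.atW X e.1 := hx ▸ Finset.mem_singleton_self x
      have hx' := mem_atW.1 hx
      exact ⟨x, hx, M.gt_trans e.1 x hx'.2.1 _ haE e heE hx'.2.2 haw rfl hxa hgt⟩
    · rw [h.atW_of_forall_ne fun a ha hc => hw ⟨a, ha, hc⟩] at hx'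
      exact ⟨x', hx', hgt⟩
  · obtain ⟨a, ha⟩ := h.nonempty
    obtain ⟨haE, ⟨x, hx, hxa⟩, -⟩ := (h.isWAdmissible ha).1
    refine ⟨a, Finset.mem_filter.2 ⟨haE, x, hx ▸ Finset.mem_singleton_self x, hxa⟩, fun hd => ?_⟩
    obtain ⟨-, x', hx', hgt⟩ := Finset.mem_filter.1 hd
    rw [h.atW_of_mem hX ha] at hx'
    obtain rfl := Finset.mem_singleton.1 hx'
    exact M.gt_irrefl _ _ haE rfl hgt

/-! ### Comparing two stable matchings -/

lemma PrecEq.interestingF_of_mem (h : M.PrecEq X Y) {e : W × F} (heE : e ∈ M.E) (heY : e ∈ Y)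
    (heX : e ∉ X) : M.InterestingF X e := by
  have he : e ∈ M.atF Y e.2 := mem_atF.2 ⟨heY, heE, rfl⟩
  refine ⟨Finset.mem_sdiff.2 ⟨heE, heX⟩, M.choice_substitutable e.2
    (M.atF Y e.2 ∪ M.atF X e.2) (Finset.union_subset (atF_subset _) (atF_subset _)) _
    (Finset.insert_subset (Finset.mem_union_left _ he) Finset.subset_union_right)
    (Finset.mem_inter.2 ⟨(h e.2).symm ▸ he, Finset.mem_insert_self _ _⟩)⟩

lemma Stable.image_fst_subset (hX : M.Stable X) (hY : M.Acceptable Y) (h : M.PrecEq X Y) :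
    Y.image Prod.fst ⊆ X.image Prod.fst := by
  intro w hw
  obtain ⟨e, he, rfl⟩ := Finset.mem_image.1 hw
  by_cases heX : e ∈ X
  · exact Finset.mem_image_of_mem _ heX
  · obtain ⟨-, ⟨x, hx, -⟩, -⟩ := hX.isCandidate (h.interestingF_of_mem (hY.1 he) he heX)
    have hx : x ∈ M.atW X e.1 := hx ▸ Finset.mem_singleton_self x
    exact Finset.mem_image.2 ⟨x, (mem_atW.1 hx).1, (mem_atW.1 hx).2.2⟩

lemma Acceptable.card_image_fst (hX : M.Acceptable X) : (X.image Prod.fst).card = X.card :=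
  Finset.card_image_of_injOn hX.injOn_fst

lemma Acceptable.card_atF_le (hX : M.Acceptable X) (h : M.PrecEq X Y) (f : F) :
    (M.atF X f).card ≤ (M.atF Y f).card := by
  have := M.choice_card_mono f (M.atF Y f ∪ M.atF X f)
    (Finset.union_subset (atF_subset _) (atF_subset _)) _ Finset.subset_union_right
  rwa [hX.2.2 f, h f] at this

lemma Acceptable.card_eq_sum [Fintype F] (hX : M.Acceptable X) :
    X.card = ∑ f, (M.atF X f).card := by
  rw [Finset.card_eq_sum_card_fiberwise (f := Prod.snd) (t := Finset.univ) (by simp)]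
  refine Finset.sum_congr rfl fun f _ => congrArg _ ?_
  ext e
  simp only [Finset.mem_filter, mem_atF]
  exact ⟨fun h => ⟨h.1, hX.1 h.1, h.2⟩, fun h => ⟨h.1, h.2.2⟩⟩

lemma Stable.card_eq [Finite F] (hX : M.Stable X) (hY : M.Acceptable Y) (h : M.PrecEq X Y) :
    X.card = Y.card := by
  have := Fintype.ofFinite F
  refine le_antisymm ?_ ?_
  · rw [hX.1.card_eq_sum, hY.card_eq_sum]
    exact Finset.sum_le_sum fun f _ => hX.1.card_atF_le h f
  · rw [← hX.1.card_image_fst, ← hY.card_image_fst]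
    exact Finset.card_le_card (hX.image_fst_subset hY h)

/-- No firm loses a position by `Acceptable.card_atF_le`, and the total does not grow, because each
worker filled in `Y` is filled in `X`. -/
lemma Stable.card_atF_eq [Finite F] (hX : M.Stable X) (hY : M.Acceptable Y) (h : M.PrecEq X Y)
    (f : F) : (M.atF X f).card = (M.atF Y f).card := by
  have := Fintype.ofFinite F
  have hs := hX.card_eq hY h
  rw [hX.1.card_eq_sum, hY.card_eq_sum] at hs
  exact (Finset.sum_eq_sum_iff_of_le fun f _ => hX.1.card_atF_le h f).1 hs f (Finset.mem_univ f)

lemma Stable.exists_mem_atW_of_ne [Finite F] (hX : M.Stable X) (hY : M.Acceptable Y)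
    (h : M.PrecEq X Y) {w : W} (hw : M.atW X w ≠ M.atW Y w) :
    ∃ y ∈ M.atW Y w, y ∉ X := by
  have himg : Y.image Prod.fst = X.image Prod.fst :=
    Finset.eq_of_subset_of_card_le (hX.image_fst_subset hY h) (by
      rw [hX.1.card_image_fst, hY.card_image_fst, hX.card_eq hY h])
  by_contra! hc
  refine hw (Finset.Subset.antisymm (fun e he => ?_) fun e he =>
    mem_atW.2 ⟨hc e he, (mem_atW.1 he).2⟩)
  obtain ⟨heX, heE, rfl⟩ := mem_atW.1 he
  obtain ⟨y, hy, hyw⟩ := Finset.mem_image.1 (himg ▸ Finset.mem_image_of_mem Prod.fst heX)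
  have hyY : y ∈ M.atW Y e.1 := mem_atW.2 ⟨hy, hY.1 hy, hyw⟩
  obtain rfl := hX.1.injOn_fst heX (hc y hyY) hyw.symm
  exact hyY

/-- At a worker where `X` and `Y` differ, the admissible edge for `X` brings no improvement over `Y`
to its firm: either it is in `Y`, or else its worker prefers it to the edge held in `Y`, and it would
block `Y` if the firm wanted it. -/
lemma IsWAdmissible.choice_insert_union [Finite F] (hX : M.Stable X) (hY : M.Stable Y)
    (h : M.PrecEq X Y) {a : W × F} (ha : M.IsWAdmissible X a)
    (hw : M.atW X a.1 ≠ M.atW Y a.1) :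
    M.choice a.2 (insert a (M.atF Y a.2 ∪ M.atF X a.2)) = M.atF Y a.2 := by
  have hU : M.atF Y a.2 ∪ M.atF X a.2 ⊆ M.E.filter (fun e => e.2 = a.2) :=
    Finset.union_subset (atF_subset _) (atF_subset _)
  by_cases haY : a ∈ Y
  · rw [Finset.insert_eq_of_mem (Finset.mem_union_left _ (mem_atF.2 ⟨haY, ha.mem_E, rfl⟩)), h a.2]
  have hIU := insert_atF_subset ha.mem_E rfl hU
  rw [choice_insert_of_notMem hIU, h a.2]
  intro hmem
  have haI : M.InterestingF Y a := ⟨Finset.mem_sdiff.2 ⟨ha.mem_E, haY⟩,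
    M.choice_substitutable a.2 _ hIU _ (Finset.insert_subset_insert _ Finset.subset_union_left)
      (Finset.mem_inter.2 ⟨hmem, Finset.mem_insert_self _ _⟩)⟩
  obtain ⟨-, ⟨y', hy', hgt⟩, -⟩ := hY.isCandidate haI
  obtain ⟨y, hy, hyX⟩ := hX.exists_mem_atW_of_ne hY.1 h hw
  obtain rfl := Finset.mem_singleton.1 (hy' ▸ hy)
  obtain ⟨hyY, hyE, hyw⟩ := mem_atW.1 hy
  exact gt_asymm hyE ha.mem_E hyw rfl hgt (ha.2 y
    (hX.isCandidate (h.interestingF_of_mem hyE hyY hyX)) hyw fun hya => haY (hya ▸ hyY))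

/-- The edge associated with an admissible edge exists, and leads to a worker at which `X` and
`Y` differ. -/
lemma Stable.exists_tandem_of_atW_ne [Finite F] (hX : M.Stable X) (hY : M.Stable Y)
    (h : M.PrecEq X Y) {w : W} (hw : M.atW X w ≠ M.atW Y w) :
    ∃ a b, a.1 = w ∧ M.IsTandem X a b ∧ M.atW X b.1 ≠ M.atW Y b.1 := by
  obtain ⟨y, hy, hyX⟩ := hX.exists_mem_atW_of_ne hY.1 h hw
  obtain ⟨hyY, hyE, rfl⟩ := mem_atW.1 hy
  obtain ⟨a, haw, ha⟩ :=
    (hX.isCandidate (h.interestingF_of_mem hyE hyY hyX)).exists_isWAdmissible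
  have hch := ha.choice_insert_union hX hY h (haw ▸ hw)
  have hIU := insert_atF_subset ha.mem_E rfl (Finset.union_subset
    (atF_subset (M := M) (X := Y) a.2) (atF_subset (M := M) (X := X) a.2))
  have hIX := insert_atF_subset ha.mem_E rfl (atF_subset (M := M) (X := X) a.2)
  have hsub : insert a (M.atF X a.2) ⊆ insert a (M.atF Y a.2 ∪ M.atF X a.2) :=
    Finset.insert_subset_insert _ Finset.subset_union_right
  have haX : a ∉ M.atF X a.2 := fun hc => ha.notMem (mem_atF.1 hc).1
  set C := M.choice a.2 (insert a (M.atF X a.2)) with hC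
  have haC : a ∈ C := ha.1.2.2.2
  have hCs : C ⊆ insert a (M.atF X a.2) := M.choice_subset a.2 _ hIX
  -- Cardinal monotonicity squeezes `|C|` between `|X_f|` and `|Y_f| = |X_f|`.
  have hcard : C.card = (M.atF X a.2).card := by
    refine le_antisymm ?_ ?_
    · have := M.choice_card_mono a.2 _ hIU _ hsub
      rwa [hch, ← hX.card_atF_eq hY.1 h] at this
    · have := M.choice_card_mono a.2 _ hIX _ (Finset.subset_insert _ _)
      rwa [hX.1.2.2 a.2] at this
  obtain ⟨b, hb⟩ : ∃ b, insert a (M.atF X a.2) \ C = {b} := by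
    rw [← Finset.card_eq_one, Finset.card_sdiff_of_subset hCs, hcard,
      Finset.card_insert_of_notMem haX, Nat.add_sub_cancel_left]
  have hbm : b ∈ insert a (M.atF X a.2) \ C := hb ▸ Finset.mem_singleton_self b
  obtain ⟨hbI, hbC⟩ := Finset.mem_sdiff.1 hbm
  have hba : b ≠ a := fun hc => hbC (hc ▸ haC)
  have hbX := (Finset.mem_insert.1 hbI).resolve_left hba
  obtain ⟨hbX', hbE, hbf⟩ := mem_atF.1 hbX
  refine ⟨a, b, haw, ⟨ha, hbX, ?_⟩, fun heq => ?_⟩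
  · rw [← hC, ← Finset.sdiff_sdiff_eq_self hCs, hb, Finset.sdiff_singleton_eq_erase,
      Finset.erase_insert_of_ne hba.symm]
  · -- An edge kept by `f` in `Y` would by substitutability be chosen from `X_f + a` as well.
    have hbY : b ∈ Y := (mem_atW.1 (heq ▸ mem_atW.2 ⟨hbX', hbE, rfl⟩)).1
    refine hbC (M.choice_substitutable a.2 _ hIU _ hsub (Finset.mem_inter.2 ⟨?_, hbI⟩))
    rw [hch]
    exact mem_atF.2 ⟨hbY, hbE, hbf⟩

lemma Acceptable.exists_atW_ne (hX : M.Acceptable X) (hY : M.Acceptable Y) (hne : X ≠ Y) :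
    ∃ w, M.atW X w ≠ M.atW Y w := by
  by_contra! hc
  refine hne (Finset.ext fun e => ⟨fun he => ?_, fun he => ?_⟩)
  · exact (mem_atW.1 (hc e.1 ▸ mem_atW.2 ⟨he, hX.1 he, rfl⟩)).1
  · exact (mem_atW.1 ((hc e.1).symm ▸ mem_atW.2 ⟨he, hY.1 he, rfl⟩)).1

/-! ### Rotations leading towards a larger stable matching -/

lemma exists_mem_periodicPts {α : Type*} [Finite α] [Nonempty α] (g : α → α) :
    ∃ x, x ∈ Function.periodicPts g := by
  obtain ⟨x⟩ := ‹Nonempty α›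
  obtain ⟨m, n, hmn, heq⟩ := Finite.exists_ne_map_eq_of_infinite fun k : ℕ => g^[k] x
  wlog hlt : m < n generalizing m n
  · exact this n m hmn.symm heq.symm (lt_of_le_of_ne (not_lt.1 hlt) hmn.symm)
  refine ⟨g^[m] x, n - m, Nat.sub_pos_of_lt hlt, ?_⟩
  rw [Function.IsPeriodicPt, Function.IsFixedPt, ← Function.iterate_add_apply,
    Nat.sub_add_cancel hlt.le]
  exact heq.symm

lemma Stable.exists_isRotation [Finite W] [Finite F] (hX : M.Stable X) (hY : M.Stable Y)
    (h : M.Prec X Y) :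
    ∃ Lp Lm, M.IsRotation X Lp Lm ∧ ∀ a ∈ Lp, M.atW X a.1 ≠ M.atW Y a.1 := by
  let S := {w : W // M.atW X w ≠ M.atW Y w}
  have hne : Nonempty S := let ⟨w, hw⟩ := hX.1.exists_atW_ne hY.1 h.1; ⟨⟨w, hw⟩⟩
  have hex : ∀ w : S, ∃ a b, a.1 = w.1 ∧ M.IsTandem X a b ∧ M.atW X b.1 ≠ M.atW Y b.1 :=
    fun w => hX.exists_tandem_of_atW_ne hY h.2 w.2
  choose a b haw ht hb using hex
  let g : S → S := fun w => ⟨(b w).1, hb w⟩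
  obtain ⟨s, hs⟩ := exists_mem_periodicPts g
  obtain ⟨n, hn⟩ : ∃ n, Function.minimalPeriod g s = n + 1 :=
    Nat.exists_eq_succ_of_ne_zero (Function.minimalPeriod_pos_of_mem_periodicPts hs).ne'
  let c : Fin (n + 1) → S := fun i => g^[i] s
  have hc : Function.Injective c := fun i j hij => Fin.ext
    (Function.iterate_injOn_Iio_minimalPeriod (Set.mem_Iio.2 (i.2.trans_eq hn.symm))
      (Set.mem_Iio.2 (j.2.trans_eq hn.symm)) hij)
  have hstep : ∀ i, c (i + 1) = g (c i) := fun i => by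
    have h1 : ((i + 1 : Fin (n + 1)) : ℕ) = (i + 1) % Function.minimalPeriod g s := by
      rw [hn, Fin.val_add]
      simp
    simp only [c]
    rw [h1, Function.iterate_mod_minimalPeriod_eq, Function.iterate_succ_apply']
  refine ⟨_, _, isRotation_of_cycle hX.1 (a := fun i => a (c i)) (b := fun i => b (c i))
    (fun i j hij => hc (Subtype.ext ?_)) (fun i => ht _) (fun i => ?_), fun e he => ?_⟩
  · rw [← haw, ← haw]
    exact congrArg Prod.fst hij
  · rw [haw, hstep]
  · obtain ⟨i, -, rfl⟩ := Finset.mem_image.1 he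
    exact (haw (c i)).symm ▸ (c i).2

/-- A rotation through workers at which `X` and `Y` differ does not overshoot `Y`. -/
lemma IsRotation.precEq_of_atW_ne [Finite F] (hX : M.Stable X) (hY : M.Stable Y)
    (h : M.PrecEq X Y) (hL : M.IsRotation X Lp Lm)
    (hne : ∀ a ∈ Lp, M.atW X a.1 ≠ M.atW Y a.1) : M.PrecEq ((X \ Lm) ∪ Lp) Y := by
  intro f
  have hU : M.atF Y f ∪ M.atF X f ⊆ M.E.filter (fun e => e.2 = f) :=
    Finset.union_subset (atF_subset _) (atF_subset _)
  have hV : M.atF Y f ∪ M.atF X f ∪ M.atF Lp f ⊆ M.E.filter (fun e => e.2 = f) :=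
    Finset.union_subset hU (atF_subset _)
  have hsub : M.choice f (M.atF Y f ∪ M.atF X f ∪ M.atF Lp f) ⊆ M.atF Y f ∪ M.atF X f := by
    intro e he
    rcases Finset.mem_union.1 (M.choice_subset f _ hV he) with h1 | h1
    · exact h1
    · obtain ⟨heL, heE, rfl⟩ := mem_atF.1 h1
      refine Finset.mem_union_left _ ?_
      rw [← (hL.isWAdmissible heL).choice_insert_union hX hY h (hne e heL)]
      exact M.choice_substitutable e.2 _ hV _
        (Finset.insert_subset (Finset.mem_union_right _ h1) Finset.subset_union_left)
        (Finset.mem_inter.2 ⟨he, Finset.mem_insert_self _ _⟩)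
  have hVY : M.choice f (M.atF Y f ∪ M.atF X f ∪ M.atF Lp f) = M.atF Y f :=
    (M.choice_consistent f _ hV _ Finset.subset_union_left hsub).symm.trans (h f)
  refine (M.choice_consistent f _ hV (M.atF Y f ∪ M.atF ((X \ Lm) ∪ Lp) f) (fun e he => ?_) ?_).trans
    hVY
  · simp only [mem_atF, Finset.mem_union, Finset.mem_sdiff] at he ⊢
    tauto
  · rw [hVY]
    exact Finset.subset_union_left

end CBModel

theorem proposition3p2 {W F : Type*} [Finite W] [Finite F] [DecidableEq W] [DecidableEq F]
    (M : CBModel W F) (X Y : Finset (W × F)) (hX : M.Stable X) (hY : M.Stable Y)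
    (hXY : M.Prec X Y) :
    (∃ X' ∈ M.rotated X, M.Stable X' ∧ M.Prec X X' ∧ M.PrecEq X' Y) ∧
    (∃ (N : ℕ) (T : ℕ → Finset (W × F)), T 0 = X ∧ T N = Y ∧ (∀ i ≤ N, M.Stable (T i)) ∧
      ∀ i < N, T (i + 1) ∈ M.rotated (T i) ∧ M.Prec (T i) (T (i + 1))) := by
  have step : ∀ X, M.Stable X → M.Prec X Y → ∃ X' ∈ M.rotated X,
      M.Stable X' ∧ M.Prec X X' ∧ M.PrecEq X' Y ∧ M.dominated X' ⊂ M.dominated X := by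
    intro X hX hXY
    obtain ⟨Lp, Lm, hL, hne⟩ := hX.exists_isRotation hY hXY
    exact ⟨_, ⟨Lp, Lm, hL, rfl⟩, hL.stable hX, hL.prec hX.1,
      hL.precEq_of_atW_ne hX hY hXY.2 hne, hL.dominated_ssubset hX.1⟩
  have chain : ∀ (D : Finset (W × F)) (X : Finset (W × F)), M.dominated X = D → M.Stable X →
      M.PrecEq X Y → ∃ (N : ℕ) (T : ℕ → Finset (W × F)), T 0 = X ∧ T N = Y ∧
        (∀ i ≤ N, M.Stable (T i)) ∧
        ∀ i < N, T (i + 1) ∈ M.rotated (T i) ∧ M.Prec (T i) (T (i + 1)) := by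
    intro D
    induction D using Finset.strongInduction with
    | H D ih =>
      rintro X rfl hX hXY
      by_cases heq : X = Y
      · exact ⟨0, fun _ => X, rfl, heq, fun _ _ => hX, fun i hi => absurd hi (Nat.not_lt_zero i)⟩
      obtain ⟨X', hrot, hX', hlt, hle, hd⟩ := step X hX ⟨heq, hXY⟩
      obtain ⟨N, T, h0, hN, hst, hT⟩ := ih _ hd X' rfl hX' hle
      refine ⟨N + 1, fun i => Nat.casesOn i X T, rfl, hN, fun i hi => ?_, fun i hi => ?_⟩
      · cases i with
        | zero => exact hX
        | succ i => exact hst i (Nat.le_of_succ_le_succ hi)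
      · cases i with
        | zero =>
          change T 0 ∈ M.rotated X ∧ M.Prec X (T 0)
          rw [h0]
          exact ⟨hrot, hlt⟩
        | succ i => exact hT i (Nat.lt_of_succ_lt_succ hi)
  obtain ⟨X', hrot, hX', hlt, hle, -⟩ := step X hX hXY
  exact ⟨⟨X', hrot, hX', hlt, hle⟩, chain _ X rfl hX hXY.2⟩
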